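/- Let $K$ be a field that is complete for a nontrivial discrete valuation $\mathrm{val}\colon K\to\mathbb Z\cup\{+\infty\}$, let $n\ge 0$, and for $\mathbf r\in\mathbb Q^n$ let $$K\{\mathbf X;\mathbf r\}=\Big\{\sum_{\mathbf i\in\mathbb N^n}a_{\mathbf i}\mathbf X^{\mathbf i}\in K[[X_1,\dots,X_n]] : \mathrm{val}(a_{\mathbf i})-\mathbf r\cdot\mathbf i\to+\infty \text{ as } |\mathbf i|\to+\infty\Big\}$$ be the Tate algebra with log-radii $\mathbf r$. Let $\mathrm{val}_{\mathbf r}\big(\sum a_{\mathbf i}\mathbf X^{\mathbf i}\big)=\min_{\mathbf i}\big(\mathrm{val}(a_{\mathbf i})-\mathbf r\cdot\mathbf i\big)$ be its Gauss valuation and $\|f\|_{\mathbf r}=e^{-\mathrm{val}_{\mathbf r}(f)}$ the associated Gauss norm. Lemma. Let $\mathbf r,\mathbf u\in\mathbb Q^n$ with $r_i\ge u_i$ for all $i$, so that $K\{\mathbf X;\mathbf r\}\subset K\{\mathbf X;\mathbf u\}$. Let $I$ be a $0$-dimensional ideal of $K\{\mathbf X;\mathbf r\}$, that is, an ideal such that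 $K\{\mathbf X;\mathbf r\}/I$ is a finite-dimensional $K$-vector space, and let $J=I\cdot K\{\mathbf X;\mathbf u\}$ be the ideal of $K\{\mathbf X;\mathbf u\}$ generated by $I$. Then $J$ is the closure of $I$ in $K\{\mathbf X;\mathbf u\}$ for the topology defined by the norm $\|\cdot\|_{\mathbf u}$. -/

import Mathlib

open scoped WithZero

namespace TateAlgebra

section Valuation

variable {K : Type*} [Field K] [Valued K ℤᵐ⁰]

/-- The additive valuation `val : K → ℤ ∪ {+∞}` of a discretely valued field, read in the extended
reals: `val 0 = +∞`, and `val a = m` when the multiplicative valuation of `a` is `exp (-m)`. -/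
noncomputable def val (a : K) : EReal :=
  open scoped Classical in
  if a = 0 then ⊤ else (((-WithZero.log (Valued.v a) : ℤ) : ℝ) : EReal)

theorem val_zero : val (0 : K) = ⊤ := by simp [val]

theorem val_of_ne_zero {a : K} (ha : a ≠ 0) :
    val a = (((-WithZero.log (Valued.v a) : ℤ) : ℝ) : EReal) := by simp [val, ha]

theorem val_eq_top_iff {a : K} : val a = ⊤ ↔ a = 0 := by
  refine ⟨fun h => ?_, fun h => h ▸ val_zero⟩
  by_contra ha
  rw [val_of_ne_zero ha] at h
  exact EReal.coe_ne_top _ h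

theorem val_ne_bot (a : K) : val a ≠ ⊥ := by
  by_cases ha : a = 0
  · simp [ha, val_zero]
  · rw [val_of_ne_zero ha]
    exact EReal.coe_ne_bot _

theorem val_mul (a b : K) : val (a * b) = val a + val b := by
  by_cases ha : a = 0
  · subst ha
    rw [zero_mul, val_zero, EReal.top_add_of_ne_bot (val_ne_bot b)]
  by_cases hb : b = 0
  · subst hb
    rw [mul_zero, val_zero, EReal.add_top_of_ne_bot (val_ne_bot a)]
  have ha' : Valued.v a ≠ 0 := (Valuation.ne_zero_iff _).2 ha
  have hb' : Valued.v b ≠ 0 := (Valuation.ne_zero_iff _).2 hb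
  rw [val_of_ne_zero ha, val_of_ne_zero hb, val_of_ne_zero (mul_ne_zero ha hb), map_mul,
    WithZero.log_mul ha' hb', ← EReal.coe_add, EReal.coe_eq_coe_iff]
  push_cast
  ring

theorem val_neg (a : K) : val (-a) = val a := by
  by_cases ha : a = 0
  · simp [ha]
  · rw [val_of_ne_zero ha, val_of_ne_zero (neg_ne_zero.2 ha), Valuation.map_neg]

theorem min_val_le_val_add (a b : K) : min (val a) (val b) ≤ val (a + b) := by
  by_cases ha : a = 0
  · simp [ha]
  by_cases hb : b = 0
  · simp [hb]
  by_cases hab : a + b = 0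
  · simp [hab, val_zero]
  have ha' : Valued.v a ≠ 0 := (Valuation.ne_zero_iff _).2 ha
  have hb' : Valued.v b ≠ 0 := (Valuation.ne_zero_iff _).2 hb
  have hab' : Valued.v (a + b) ≠ 0 := (Valuation.ne_zero_iff _).2 hab
  rw [val_of_ne_zero ha, val_of_ne_zero hb, val_of_ne_zero hab, min_le_iff, EReal.coe_le_coe_iff,
    EReal.coe_le_coe_iff, Int.cast_le, Int.cast_le, neg_le_neg_iff, neg_le_neg_iff,
    WithZero.log_le_log hab' ha', WithZero.log_le_log hab' hb', ← le_max_iff]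
  exact Valuation.map_add _ _ _

theorem lt_val_sum {ι : Type*} (s : Finset ι) (f : ι → K) (M : ℝ)
    (h : ∀ i ∈ s, (M : EReal) < val (f i)) : (M : EReal) < val (∑ i ∈ s, f i) := by
  classical
  induction s using Finset.induction_on with
  | empty => simp [val_zero, EReal.coe_lt_top]
  | insert a s ha ih =>
    rw [Finset.sum_insert ha]
    refine lt_of_lt_of_le (lt_min ?_ ?_) (min_val_le_val_add _ _)
    · exact h a (Finset.mem_insert_self a s)
    · exact ih fun i hi => h i (Finset.mem_insert_of_mem hi)

end Valuation

section Term

variable {K : Type*} [Field K] [Valued K ℤᵐ⁰] {n : ℕ}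

/-- The dot product `r · i`. -/
def dot (r : Fin n → ℚ) (i : Fin n →₀ ℕ) : ℚ := ∑ j, r j * (i j : ℚ)

theorem dot_add (r : Fin n → ℚ) (i j : Fin n →₀ ℕ) : dot r (i + j) = dot r i + dot r j := by
  simp [dot, mul_add, Finset.sum_add_distrib]

theorem dot_le_dot {u r : Fin n → ℚ} (h : u ≤ r) (i : Fin n →₀ ℕ) : dot u i ≤ dot r i :=
  Finset.sum_le_sum fun j _ => mul_le_mul_of_nonneg_right (h j) (Nat.cast_nonneg _)

/-- The Gauss valuation `val a - r · i` of the term `a X ^ i`. -/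
noncomputable def termVal (r : Fin n → ℚ) (i : Fin n →₀ ℕ) (a : K) : EReal :=
  val a - ((dot r i : ℝ) : EReal)

theorem lt_termVal_iff (r : Fin n → ℚ) (i : Fin n →₀ ℕ) (a : K) (M : ℝ) :
    (M : EReal) < termVal r i a ↔ ((M + dot r i : ℝ) : EReal) < val a := by
  rw [termVal, EReal.lt_sub_iff_add_lt (.inl (EReal.coe_ne_bot _)) (.inl (EReal.coe_ne_top _)),
    EReal.coe_add]

theorem termVal_ne_bot (r : Fin n → ℚ) (i : Fin n →₀ ℕ) (a : K) : termVal r i a ≠ ⊥ := by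
  rw [termVal, sub_eq_add_neg, ← EReal.coe_neg]
  exact EReal.add_ne_bot_iff.2 ⟨val_ne_bot a, EReal.coe_ne_bot _⟩

theorem termVal_zero (r : Fin n → ℚ) (i : Fin n →₀ ℕ) : termVal r i (0 : K) = ⊤ := by
  rw [termVal, val_zero, EReal.top_sub_coe]

theorem termVal_eq_top_iff (r : Fin n → ℚ) (i : Fin n →₀ ℕ) (a : K) :
    termVal r i a = ⊤ ↔ a = 0 := by
  refine ⟨fun h => ?_, fun h => h ▸ termVal_zero r i⟩
  by_contra ha
  rw [termVal, val_of_ne_zero ha, ← EReal.coe_sub] at h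
  exact EReal.coe_ne_top _ h

theorem termVal_neg (r : Fin n → ℚ) (i : Fin n →₀ ℕ) (a : K) :
    termVal r i (-a) = termVal r i a := by rw [termVal, val_neg, termVal]

theorem min_termVal_le (r : Fin n → ℚ) (i : Fin n →₀ ℕ) (a b : K) :
    min (termVal r i a) (termVal r i b) ≤ termVal r i (a + b) := by
  rcases min_le_iff.1 (min_val_le_val_add a b) with h | h
  · exact (min_le_left _ _).trans (EReal.sub_le_sub h le_rfl)
  · exact (min_le_right _ _).trans (EReal.sub_le_sub h le_rfl)

theorem termVal_mul (r : Fin n → ℚ) (i j : Fin n →₀ ℕ) (a b : K) :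
    termVal r (i + j) (a * b) = termVal r i a + termVal r j b := by
  by_cases ha : a = 0
  · subst ha
    rw [zero_mul, termVal_zero, termVal_zero, EReal.top_add_of_ne_bot (termVal_ne_bot r j b)]
  by_cases hb : b = 0
  · subst hb
    rw [mul_zero, termVal_zero, termVal_zero, EReal.add_top_of_ne_bot (termVal_ne_bot r i a)]
  simp only [termVal, val_mul, val_of_ne_zero ha, val_of_ne_zero hb, dot_add]
  norm_cast
  push_cast
  ring

theorem lt_termVal_sum {ι : Type*} (r : Fin n → ℚ) (i : Fin n →₀ ℕ) (s : Finset ι) (f : ι → K)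
    (M : ℝ) (h : ∀ k ∈ s, (M : EReal) < termVal r i (f k)) :
    (M : EReal) < termVal r i (∑ k ∈ s, f k) := by
  rw [lt_termVal_iff]
  exact lt_val_sum s f _ fun k hk => (lt_termVal_iff r i _ M).1 (h k hk)

end Term

section Series

variable {K : Type*} [Field K] [Valued K ℤᵐ⁰] {n : ℕ}

/-- The convergence condition with log-radii `r`: `val a_i - r · i → +∞` as `|i| → +∞`.
There are finitely many `i ∈ ℕ ^ n` of each total degree, so that `|i| → +∞` is the cofinite
filter. -/
def IsConvergent (r : Fin n → ℚ) (f : MvPowerSeries (Fin n) K) : Prop :=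
  Filter.Tendsto (fun i => termVal r i (MvPowerSeries.coeff i f)) Filter.cofinite (nhds ⊤)

/-- The Gauss valuation of a series, the minimum of the Gauss valuations of its terms. -/
noncomputable def gaussVal (r : Fin n → ℚ) (f : MvPowerSeries (Fin n) K) : EReal :=
  ⨅ i, termVal r i (MvPowerSeries.coeff i f)

theorem isConvergent_iff (r : Fin n → ℚ) (f : MvPowerSeries (Fin n) K) :
    IsConvergent r f ↔
      ∀ M : ℝ, {i | ¬ (M : EReal) < termVal r i (MvPowerSeries.coeff i f)}.Finite := by
  simp only [IsConvergent, EReal.tendsto_nhds_top_iff_real, Filter.eventually_cofinite]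

theorem IsConvergent.exists_lt {r : Fin n → ℚ} {f : MvPowerSeries (Fin n) K}
    (hf : IsConvergent r f) :
    ∃ m : ℝ, ∀ i, (m : EReal) < termVal r i (MvPowerSeries.coeff i f) := by
  have hfin := (isConvergent_iff r f).1 hf 0
  have key : ∀ S : Set (Fin n →₀ ℕ), S.Finite → ∃ m : ℝ, m ≤ 0 ∧
      ∀ i ∈ S, (m : EReal) < termVal r i (MvPowerSeries.coeff i f) := by
    intro S hS
    induction S, hS using Set.Finite.induction_on with
    | empty => exact ⟨0, le_rfl, by simp⟩
    | @insert a S _ _ ih =>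
      obtain ⟨m, hm0, hm⟩ := ih
      obtain ⟨x, hx⟩ := EReal.lt_iff_exists_real_btwn.1
        (bot_lt_iff_ne_bot.2 (termVal_ne_bot r a (MvPowerSeries.coeff a f)))
      refine ⟨min m x, (min_le_left _ _).trans hm0, ?_⟩
      rintro i (rfl | hi)
      · exact lt_of_le_of_lt (EReal.coe_le_coe_iff.2 (min_le_right _ _)) hx.2
      · exact lt_of_le_of_lt (EReal.coe_le_coe_iff.2 (min_le_left _ _)) (hm i hi)
  obtain ⟨m, hm0, hm⟩ := key _ hfin
  refine ⟨m, fun i => ?_⟩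
  by_cases hi : ((0 : ℝ) : EReal) < termVal r i (MvPowerSeries.coeff i f)
  · exact lt_of_le_of_lt (EReal.coe_le_coe_iff.2 hm0) hi
  · exact hm i hi

theorem isConvergent_C (r : Fin n → ℚ) (a : K) :
    IsConvergent r (MvPowerSeries.C a : MvPowerSeries (Fin n) K) := by
  classical
  rw [isConvergent_iff]
  refine fun M => (Set.finite_singleton (0 : Fin n →₀ ℕ)).subset fun i hi => ?_
  by_contra h0
  refine hi ?_
  rw [MvPowerSeries.coeff_C, if_neg fun h => h0 (Set.mem_singleton_iff.2 h), termVal_zero]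
  exact EReal.coe_lt_top M

theorem IsConvergent.add {r : Fin n → ℚ} {f g : MvPowerSeries (Fin n) K}
    (hf : IsConvergent r f) (hg : IsConvergent r g) : IsConvergent r (f + g) := by
  rw [isConvergent_iff] at *
  refine fun M => ((hf M).union (hg M)).subset fun i hi => ?_
  by_contra h
  simp only [Set.mem_union, Set.mem_ofPred_eq, not_or, not_not] at h
  refine hi ?_
  rw [map_add]
  exact lt_of_lt_of_le (lt_min h.1 h.2) (min_termVal_le r i _ _)

theorem IsConvergent.mul {r : Fin n → ℚ} {f g : MvPowerSeries (Fin n) K}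
    (hf : IsConvergent r f) (hg : IsConvergent r g) : IsConvergent r (f * g) := by
  classical
  obtain ⟨mf, hmf⟩ := hf.exists_lt
  obtain ⟨mg, hmg⟩ := hg.exists_lt
  rw [isConvergent_iff] at *
  refine fun M => ((hf (M - mg)).image2 (fun i j => i + j) (hg (M - mf))).subset fun k hk => ?_
  by_contra h
  refine hk ?_
  rw [MvPowerSeries.coeff_mul]
  refine lt_termVal_sum r k _ _ M ?_
  rintro ⟨i, j⟩ hij
  have hk' : i + j = k := Finset.HasAntidiagonal.mem_antidiagonal.1 hij
  subst hk'
  rw [termVal_mul]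
  by_cases hi : ((M - mg : ℝ) : EReal) < termVal r i (MvPowerSeries.coeff i f)
  · have := EReal.add_lt_add hi (hmg j)
    rwa [← EReal.coe_add, sub_add_cancel] at this
  · by_cases hj : ((M - mf : ℝ) : EReal) < termVal r j (MvPowerSeries.coeff j g)
    · have := EReal.add_lt_add (hmf i) hj
      rwa [← EReal.coe_add, add_sub_cancel] at this
    · exact absurd ⟨i, hi, j, hj, rfl⟩ h

theorem IsConvergent.mono {u r : Fin n → ℚ} (h : u ≤ r) {f : MvPowerSeries (Fin n) K}
    (hf : IsConvergent r f) : IsConvergent u f := by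
  refine tendsto_nhds_top_mono' hf fun i => ?_
  refine EReal.sub_le_sub le_rfl (EReal.coe_le_coe_iff.2 ?_)
  exact_mod_cast dot_le_dot h i

theorem le_gaussVal_add (r : Fin n → ℚ) (f g : MvPowerSeries (Fin n) K) :
    min (gaussVal r f) (gaussVal r g) ≤ gaussVal r (f + g) := by
  refine le_iInf fun i => ?_
  rw [map_add]
  exact (min_le_min (iInf_le _ i) (iInf_le _ i)).trans (min_termVal_le r i _ _)

theorem gaussVal_zero (r : Fin n → ℚ) : gaussVal r (0 : MvPowerSeries (Fin n) K) = ⊤ := by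
  simp [gaussVal, termVal_zero]

theorem gaussVal_neg (r : Fin n → ℚ) (f : MvPowerSeries (Fin n) K) :
    gaussVal r (-f) = gaussVal r f := by
  simp [gaussVal, termVal_neg]

theorem gaussVal_eq_top_iff (r : Fin n → ℚ) (f : MvPowerSeries (Fin n) K) :
    gaussVal r f = ⊤ ↔ f = 0 := by
  simp [gaussVal, iInf_eq_top, termVal_eq_top_iff, MvPowerSeries.ext_iff]

theorem IsConvergent.gaussVal_ne_bot {r : Fin n → ℚ} {f : MvPowerSeries (Fin n) K}
    (hf : IsConvergent r f) : gaussVal r f ≠ ⊥ := by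
  obtain ⟨m, hm⟩ := hf.exists_lt
  have : (m : EReal) ≤ gaussVal r f := le_iInf fun i => (hm i).le
  exact (lt_of_lt_of_le (EReal.bot_lt_coe m) this).ne'

end Series

end TateAlgebra

/-- The Tate algebra `K{X; r}` in `n` variables with convergence log-radii `r`, as a `K`-algebra of
formal power series. -/
noncomputable def tateAlgebra (K : Type*) [Field K] [Valued K ℤᵐ⁰] {n : ℕ} (r : Fin n → ℚ) :
    Subalgebra K (MvPowerSeries (Fin n) K) where
  carrier := {f | TateAlgebra.IsConvergent r f}
  mul_mem' := TateAlgebra.IsConvergent.mul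
  add_mem' := TateAlgebra.IsConvergent.add
  algebraMap_mem' := TateAlgebra.isConvergent_C r

namespace TateAlgebra

variable {K : Type*} [Field K] [Valued K ℤᵐ⁰] {n : ℕ}

/-- The Gauss norm `‖f‖_r = exp (- val_r f)` on `K{X; r}`. -/
noncomputable def gaussNorm (r : Fin n → ℚ) : AddGroupNorm (tateAlgebra K r) where
  toFun f := (EReal.exp (-gaussVal r (f : MvPowerSeries (Fin n) K))).toReal
  map_zero' := by simp [gaussVal_zero]
  neg' f := by simp [gaussVal_neg]
  add_le' f g := by
    have key : ∀ h : tateAlgebra K r, EReal.exp (-gaussVal r (h : MvPowerSeries (Fin n) K)) ≠ ⊤ := by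
      intro h
      rw [Ne, EReal.exp_eq_top_iff, EReal.neg_eq_top_iff]
      exact IsConvergent.gaussVal_ne_bot h.2
    rw [← ENNReal.toReal_add (key f) (key g)]
    refine ENNReal.toReal_mono (ENNReal.add_ne_top.2 ⟨key f, key g⟩) ?_
    rcases min_le_iff.1 (le_gaussVal_add r (f : MvPowerSeries (Fin n) K) g) with h | h
    · exact (EReal.exp_monotone (EReal.neg_le_neg_iff.2 h)).trans le_self_add
    · exact (EReal.exp_monotone (EReal.neg_le_neg_iff.2 h)).trans le_add_self
  eq_zero_of_map_eq_zero' f hf := by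
    rcases (ENNReal.toReal_eq_zero_iff _).1 hf with h | h
    · rw [EReal.exp_eq_zero_iff, EReal.neg_eq_bot_iff, gaussVal_eq_top_iff] at h
      exact Subtype.ext h
    · rw [EReal.exp_eq_top_iff, EReal.neg_eq_top_iff] at h
      exact absurd h (IsConvergent.gaussVal_ne_bot f.2)

/-- `K{X; r}` carries the Gauss norm and its topology. -/
noncomputable instance (r : Fin n → ℚ) : NormedAddCommGroup (tateAlgebra K r) :=
  (gaussNorm r).toNormedAddCommGroup

/-- For `u ≤ r`, the inclusion of `K{X; r}` into `K{X; u}`. -/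
noncomputable def inclusion {u r : Fin n → ℚ} (h : u ≤ r) : tateAlgebra K r →ₐ[K] tateAlgebra K u :=
  Subalgebra.inclusion fun _ hf => IsConvergent.mono h hf

end TateAlgebra

/-! The inclusion of $J$ in the closure is a density argument: polynomials are dense in $K\{\mathbf
X;\mathbf u\}$ and already lie in $K\{\mathbf X;\mathbf r\}$, so the closure of $I$ is stable under
multiplication by $K\{\mathbf X;\mathbf u\}$ (`map_inclusion_subset_closure`).

The other inclusion amounts to $J$ being closed. Since $K\{\mathbf X;\mathbf r\}/I$ is finite over
$K$, each $X_i$ is a root of a nonzero $P_i$ modulo $I$, so $J$ contains every $P_i(X_i)$. Any $f$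
can be divided by these in the style of Weierstrass: $f=\sum_i q_iP_i(X_i)+\rho$, where $\rho$ is a
polynomial with exponents in a fixed finite box and Gauss valuation at least that of $f$
(`exists_gaussBall_le_map_divisionMap`).

If $f$ is in the closure of $J$ but not in $J$, take a $K$-linear form $\varphi$, not assumed
continuous, that kills $J$ but not $f$. For $g\in J$ close to $f$, the remainder $\rho$ of $f-g$ is
small and $\varphi(f)=\varphi(\rho)$. A linear form is bounded on the finite-dimensional box
(`exists_map_mem_valBall`), so $\varphi(f)$ is arbitrarily small, hence zero, a contradiction
(`isClosed_ideal`). -/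

namespace TateAlgebra

/-! ### Valuation balls and convergent series in the field $K$ -/

section Coefficients

variable {K : Type*} [Field K] [Valued K ℤᵐ⁰]

theorem coe_le_val_iff {a : K} (ha : a ≠ 0) {m : ℝ} :
    (m : EReal) ≤ val a ↔ m ≤ -((WithZero.log (Valued.v a) : ℤ) : ℝ) := by
  rw [val_of_ne_zero ha, EReal.coe_le_coe_iff]
  push_cast
  rfl

/-- The elements of `K` of valuation at least `m`. -/
def valBall (K : Type*) [Field K] [Valued K ℤᵐ⁰] (m : ℝ) : AddSubgroup K where
  carrier := {a | (m : EReal) ≤ val a}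
  zero_mem' := by simp [val_zero]
  add_mem' ha hb := (le_min ha hb).trans (min_val_le_val_add _ _)
  neg_mem' ha := by simpa [val_neg] using ha

theorem mem_valBall {a : K} {m : ℝ} : a ∈ valBall K m ↔ (m : EReal) ≤ val a := Iff.rfl

theorem valBall_anti {m m' : ℝ} (h : m ≤ m') : valBall K m' ≤ valBall K m :=
  fun _ ha => (EReal.coe_le_coe_iff.2 h).trans ha

theorem mul_mem_valBall {a b : K} {m m' : ℝ} (ha : a ∈ valBall K m) (hb : b ∈ valBall K m') :
    a * b ∈ valBall K (m + m') := by
  rw [mem_valBall, val_mul, EReal.coe_add]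
  exact add_le_add ha hb

theorem exists_val_eq {a : K} (ha : a ≠ 0) : ∃ e : ℝ, val a = e := ⟨_, val_of_ne_zero ha⟩

theorem exists_mem_valBall (a : K) : ∃ m : ℝ, a ∈ valBall K m := by
  by_cases ha : a = 0
  · exact ⟨0, ha ▸ zero_mem _⟩
  · obtain ⟨e, he⟩ := exists_val_eq ha
    exact ⟨e, he.ge⟩

theorem inv_mem_valBall {a : K} {e : ℝ} (he : val a = e) : a⁻¹ ∈ valBall K (-e) := by
  have ha : a ≠ 0 := by
    rintro rfl
    rw [val_zero] at he
    exact EReal.coe_ne_top _ he.symm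
  rw [val_of_ne_zero ha, EReal.coe_eq_coe_iff] at he
  rw [mem_valBall, coe_le_val_iff (inv_ne_zero ha), map_inv₀, WithZero.log_inv, ← he]

theorem eq_zero_of_forall_mem_valBall {a : K} (h : ∀ m : ℝ, a ∈ valBall K m) : a = 0 := by
  rw [← val_eq_top_iff, EReal.eq_top_iff_forall_lt]
  exact fun m => lt_of_lt_of_le (EReal.coe_lt_coe_iff.2 (lt_add_one m)) (h (m + 1))

theorem exists_valBall_subset {U : Set K} (hU : U ∈ nhds 0) : ∃ m : ℝ, (valBall K m : Set K) ⊆ U := by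
  obtain ⟨γ, hγ⟩ := Valued.mem_nhds_zero.1 hU
  set g := MonoidWithZeroHom.ValueGroup₀.embedding γ.1
  -- The basic neighbourhood is a strict inequality and the ball a large one; the extra 1 bridges
  -- the two.
  refine ⟨1 - (WithZero.log g : ℤ), fun a ha => hγ ?_⟩
  have hg : g ≠ 0 := (map_ne_zero _).2 γ.ne_zero
  rw [Set.mem_ofPred_eq, Valuation.restrict_lt_iff_lt_embedding]
  by_cases h0 : a = 0
  · rw [h0, map_zero]
    exact zero_lt_iff.2 hg
  rw [← WithZero.log_lt_log ((Valuation.ne_zero_iff _).2 h0) hg]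
  have := (coe_le_val_iff h0).1 ha
  have : ((WithZero.log (Valued.v a) : ℤ) : ℝ) < (WithZero.log g : ℤ) := by linarith
  exact_mod_cast this

theorem isOpen_valBall [hd : (Valued.v (R := K)).IsRankOneDiscrete] (m : ℝ) :
    IsOpen (valBall K m : Set K) := by
  -- Since values are integers, $\mathrm{val}(x)\ge 1$, so $\mathrm{val}(x^k)\ge k\ge m$ and the
  -- open ball of radius $|x^k|$ fits inside.
  obtain ⟨x, hxK, hx1⟩ := Valuation.IsNontrivial.exists_lt_one (v := Valued.v (R := K))
  have hx0 : Valued.v x ≠ 0 := (Valuation.ne_zero_iff _).2 hxK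
  have hlog : WithZero.log (Valued.v x) < 0 := by
    rw [← WithZero.log_one]
    exact (WithZero.log_lt_log hx0 one_ne_zero).2 hx1
  obtain ⟨k, hk⟩ := exists_nat_ge m
  have hy : Valued.v.restrict (x ^ k) ≠ 0 := by simp [hxK]
  refine AddSubgroup.isOpen_of_mem_nhds _ (g := 0) (Valued.mem_nhds_zero.2 ⟨Units.mk0 _ hy, ?_⟩)
  intro a ha
  rw [Set.mem_ofPred_eq, Units.val_mk0, Valuation.restrict_lt_iff] at ha
  by_cases h0 : a = 0
  · exact h0 ▸ zero_mem _
  rw [SetLike.mem_coe, mem_valBall, coe_le_val_iff h0]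
  rw [map_pow, ← WithZero.log_lt_log ((Valuation.ne_zero_iff _).2 h0) (pow_ne_zero _ hx0),
    WithZero.log_pow] at ha
  have h1 : WithZero.log (Valued.v a) < -(k : ℤ) := by
    refine ha.trans_le ?_
    rw [nsmul_eq_mul]
    nlinarith
  have h2 : ((WithZero.log (Valued.v a) : ℤ) : ℝ) < -(k : ℝ) := by exact_mod_cast h1
  linarith

/-- The valuation balls are open subgroups forming a neighbourhood basis of 0. Over complete $K$
this makes a series summable as soon as its terms tend to 0. -/
theorem nonarchimedeanAddGroup [(Valued.v (R := K)).IsRankOneDiscrete] :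
    NonarchimedeanAddGroup K where
  is_nonarchimedean U hU := by
    obtain ⟨m, hm⟩ := exists_valBall_subset hU
    exact ⟨⟨valBall K m, isOpen_valBall m⟩, hm⟩

/-- A series whose terms have valuations growing at least linearly converges. -/
theorem summable_of_mem_valBall [(Valued.v (R := K)).IsRankOneDiscrete] [CompleteSpace K]
    {c δ : ℝ} (hδ : 0 < δ) {g : ℕ → K} (hg : ∀ k : ℕ, g k ∈ valBall K (c + k * δ)) : Summable g := by
  have := nonarchimedeanAddGroup (K := K)
  refine NonarchimedeanAddGroup.summable_of_tendsto_cofinite_zero ?_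
  rw [Nat.cofinite_eq_atTop]
  intro U hU
  obtain ⟨m, hm⟩ := exists_valBall_subset hU
  obtain ⟨N, hN⟩ := exists_nat_ge ((m - c) / δ)
  refine Filter.mem_map.2 (Filter.mem_atTop_sets.2 ⟨N, fun k hk => hm (valBall_anti ?_ (hg k))⟩)
  have h1 : (m - c) / δ ≤ k := hN.trans (by exact_mod_cast hk)
  rw [div_le_iff₀ hδ] at h1
  linarith

theorem tsum_mem_valBall [(Valued.v (R := K)).IsRankOneDiscrete] {m : ℝ} {g : ℕ → K}
    (hg : ∀ k, g k ∈ valBall K m) : ∑' k, g k ∈ valBall K m := by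
  by_cases hs : Summable g
  · exact (AddSubgroup.isClosed_of_isOpen _ (isOpen_valBall m)).mem_of_tendsto hs.hasSum
      (Filter.Eventually.of_forall fun s => sum_mem fun k _ => hg k)
  -- The default value 0 of a divergent sum also lies in the ball, so no summability is needed.
  · rw [tsum_eq_zero_of_not_summable hs]
    exact zero_mem _

/-- The error is a tail whose terms all lie in the ball. The explicit bound is what makes
coefficientwise sums of power series uniform in the exponent. -/
theorem tsum_sub_sum_mem_valBall [(Valued.v (R := K)).IsRankOneDiscrete] [CompleteSpace K]
    {c δ : ℝ} (hδ : 0 < δ) {g : ℕ → K} (hg : ∀ k : ℕ, g k ∈ valBall K (c + k * δ)) (N : ℕ) :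
    ∑' k, g k - ∑ k ∈ Finset.range N, g k ∈ valBall K (c + N * δ) := by
  rw [← (summable_of_mem_valBall hδ hg).sum_add_tsum_nat_add N, add_sub_cancel_left]
  refine tsum_mem_valBall fun k => valBall_anti ?_ (hg (k + N))
  push_cast
  nlinarith [mul_nonneg (Nat.cast_nonneg (α := ℝ) k) hδ.le]

/-- Among the indices minimizing `val (P.coeff j) - s * j`, the last one has a gap above it. -/
theorem exists_dominant_index {P : Polynomial K} (hP : P ≠ 0) (s : ℝ) :
    ∃ (ω δ : ℝ) (d : ℕ), 0 < δ ∧ val (P.coeff d) = ((ω + s * d : ℝ) : EReal) ∧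
      (∀ j : ℕ, P.coeff j ∈ valBall K (ω + s * j)) ∧
      ∀ j : ℕ, d < j → P.coeff j ∈ valBall K (ω + δ + s * j) := by
  classical
  -- At a zero coefficient this weight is a junk value, so weights are only compared on the support.
  set w : ℕ → ℝ := fun j => -((WithZero.log (Valued.v (P.coeff j)) : ℤ) : ℝ) - s * j with hw
  have hval : ∀ j ∈ P.support, val (P.coeff j) = ((w j + s * j : ℝ) : EReal) := by
    intro j hj
    rw [val_of_ne_zero (Polynomial.mem_support_iff.1 hj), EReal.coe_eq_coe_iff, hw]
    push_cast
    ring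
  obtain ⟨d₀, hd₀, hmin⟩ := P.support.exists_min_image w (Polynomial.support_nonempty.2 hP)
  have hne : (P.support.filter fun j => w j = w d₀).Nonempty := ⟨d₀, Finset.mem_filter.2 ⟨hd₀, rfl⟩⟩
  obtain ⟨d, hd, hmax⟩ := Finset.exists_max_image _ id hne
  rw [Finset.mem_filter] at hd
  have hgap : ∃ δ > 0, ∀ j ∈ P.support.filter (fun j => d < j), w d + δ ≤ w j := by
    rcases (P.support.filter fun j => d < j).eq_empty_or_nonempty with he | hn
    -- With no nonzero coefficient above `d`, any positive gap will do.
    · exact ⟨1, one_pos, by simp [he]⟩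
    · obtain ⟨e, he, hmin'⟩ := Finset.exists_min_image _ w hn
      rw [Finset.mem_filter] at he
      refine ⟨w e - w d, sub_pos.2 (lt_of_le_of_ne (hd.2 ▸ hmin e he.1) fun h => ?_), fun j hj => ?_⟩
      · exact absurd (hmax e (Finset.mem_filter.2 ⟨he.1, h ▸ hd.2⟩)) (not_le.2 he.2)
      · linarith [hmin' j hj]
  obtain ⟨δ, hδ, hgap⟩ := hgap
  have hsupp : ∀ j (m : ℝ), (j ∈ P.support → m ≤ w j) → P.coeff j ∈ valBall K (m + s * j) := by
    intro j m hj
    by_cases h : j ∈ P.support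
    · rw [mem_valBall, hval j h, EReal.coe_le_coe_iff]
      linarith [hj h]
    · rw [Polynomial.notMem_support_iff.1 h]
      exact zero_mem _
  exact ⟨w d, δ, d, hδ, hval d hd.1, fun j => hsupp j _ fun h => hd.2 ▸ hmin j h,
    fun j hj => hsupp j _ fun h => hgap j (Finset.mem_filter.2 ⟨h, hj⟩)⟩

end Coefficients

/-! ### Gauss balls, density of polynomials, completeness, and box-supported series -/

section GaussBall

variable {K : Type*} [Field K] [Valued K ℤᵐ⁰] {n : ℕ} {r : Fin n → ℚ}

/-- The elements of `K{X; r}` of Gauss valuation at least `m`. -/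
def gaussBall (K : Type*) [Field K] [Valued K ℤᵐ⁰] {n : ℕ} (r : Fin n → ℚ) (m : ℝ) :
    AddSubgroup (tateAlgebra K r) where
  carrier := {f | (m : EReal) ≤ gaussVal r (f : MvPowerSeries (Fin n) K)}
  zero_mem' := by simp [gaussVal_zero]
  add_mem' hf hg := (le_min hf hg).trans (le_gaussVal_add r _ _)
  neg_mem' hf := by simpa [gaussVal_neg] using hf

theorem mem_gaussBall {f : tateAlgebra K r} {m : ℝ} :
    f ∈ gaussBall K r m ↔ (m : EReal) ≤ gaussVal r (f : MvPowerSeries (Fin n) K) := Iff.rfl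

theorem le_termVal_iff {i : Fin n →₀ ℕ} {a : K} {m : ℝ} :
    (m : EReal) ≤ termVal r i a ↔ a ∈ valBall K (m + dot r i) := by
  rw [termVal, EReal.le_sub_iff_add_le (.inl (EReal.coe_ne_bot _)) (.inl (EReal.coe_ne_top _)),
    mem_valBall, EReal.coe_add]

theorem mem_gaussBall_iff {f : tateAlgebra K r} {m : ℝ} :
    f ∈ gaussBall K r m ↔
      ∀ i, MvPowerSeries.coeff i (f : MvPowerSeries (Fin n) K) ∈ valBall K (m + dot r i) := by
  simp only [mem_gaussBall, gaussVal, le_iInf_iff, le_termVal_iff]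

theorem gaussBall_anti {m m' : ℝ} (h : m ≤ m') : gaussBall K r m' ≤ gaussBall K r m :=
  fun _ hf => (EReal.coe_le_coe_iff.2 h).trans hf

theorem exists_mem_gaussBall (f : tateAlgebra K r) : ∃ m : ℝ, f ∈ gaussBall K r m := by
  obtain ⟨m, hm⟩ := IsConvergent.exists_lt f.2
  exact ⟨m, le_iInf fun i => (hm i).le⟩

theorem mul_mem_gaussBall {f g : tateAlgebra K r} {m m' : ℝ} (hf : f ∈ gaussBall K r m)
    (hg : g ∈ gaussBall K r m') : f * g ∈ gaussBall K r (m + m') := by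
  classical
  rw [mem_gaussBall_iff] at *
  intro k
  rw [MulMemClass.coe_mul, MvPowerSeries.coeff_mul]
  refine sum_mem ?_
  rintro ⟨i, j⟩ hij
  rw [← Finset.HasAntidiagonal.mem_antidiagonal.1 hij, dot_add]
  convert mul_mem_valBall (hf i) (hg j) using 2
  push_cast
  ring

theorem eq_zero_of_forall_mem_gaussBall {f : tateAlgebra K r} (h : ∀ m, f ∈ gaussBall K r m) :
    f = 0 := by
  refine Subtype.ext (MvPowerSeries.ext fun i => eq_zero_of_forall_mem_valBall fun m => ?_)
  have := mem_gaussBall_iff.1 (h (m - dot r i)) i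
  rwa [sub_add_cancel] at this

theorem eq_zero_of_forall_nat_mem_gaussBall {f : tateAlgebra K r} {m δ : ℝ} (hδ : 0 < δ)
    (h : ∀ N : ℕ, f ∈ gaussBall K r (m + N * δ)) : f = 0 := by
  refine eq_zero_of_forall_mem_gaussBall fun M => ?_
  obtain ⟨N, hN⟩ := exists_nat_ge ((M - m) / δ)
  refine gaussBall_anti ?_ (h N)
  rw [div_le_iff₀ hδ] at hN
  linarith

theorem norm_lt_iff_lt_gaussVal {f : tateAlgebra K r} {m : ℝ} :
    ‖f‖ < Real.exp (-m) ↔ (m : EReal) < gaussVal r (f : MvPowerSeries (Fin n) K) := by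
  have hne : EReal.exp (-gaussVal r (f : MvPowerSeries (Fin n) K)) ≠ ⊤ := by
    rw [Ne, EReal.exp_eq_top_iff, EReal.neg_eq_top_iff]
    exact IsConvergent.gaussVal_ne_bot f.2
  change (EReal.exp (-gaussVal r (f : MvPowerSeries (Fin n) K))).toReal < _ ↔ _
  rw [← ENNReal.lt_ofReal_iff_toReal_lt hne, ← EReal.exp_coe, EReal.exp_lt_exp_iff, EReal.coe_neg,
    EReal.neg_lt_neg_iff]

/-- From here on, the topology is handled only through additive valuation bounds. -/
theorem mem_closure_iff_gaussBall {S : Set (tateAlgebra K r)} {f : tateAlgebra K r} :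
    f ∈ closure S ↔ ∀ m : ℝ, ∃ g ∈ S, f - g ∈ gaussBall K r m := by
  rw [Metric.mem_closure_iff]
  constructor
  · intro h m
    obtain ⟨g, hg, hfg⟩ := h _ (Real.exp_pos (-m))
    rw [dist_eq_norm, norm_lt_iff_lt_gaussVal] at hfg
    exact ⟨g, hg, hfg.le⟩
  · intro h ε hε
    obtain ⟨g, hg, hfg⟩ := h (-Real.log ε + 1)
    refine ⟨g, hg, ?_⟩
    rw [dist_eq_norm, ← Real.exp_log hε, ← neg_neg (Real.log ε), norm_lt_iff_lt_gaussVal]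
    exact lt_of_lt_of_le (EReal.coe_lt_coe_iff.2 (lt_add_one _)) hfg

/-- The term `a X ^ i` as an element of `K{X; r}`. -/
noncomputable def term (r : Fin n → ℚ) (i : Fin n →₀ ℕ) : K →ₗ[K] tateAlgebra K r :=
  (MvPowerSeries.monomial i).codRestrict (Subalgebra.toSubmodule (tateAlgebra K r)) <| by
    refine fun a => (isConvergent_iff r _).2 fun M => (Set.finite_singleton i).subset fun j hj => ?_
    by_contra h0
    refine hj ?_
    rw [MvPowerSeries.coeff_monomial_ne h0, termVal_zero]
    exact EReal.coe_lt_top M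

theorem coe_term (i : Fin n →₀ ℕ) (a : K) :
    (term r i a : MvPowerSeries (Fin n) K) = MvPowerSeries.monomial i a := rfl

theorem term_mem_gaussBall {i : Fin n →₀ ℕ} {a : K} {m : ℝ} (ha : a ∈ valBall K (m + dot r i)) :
    term r i a ∈ gaussBall K r m := by
  classical
  rw [mem_gaussBall_iff]
  intro j
  rw [coe_term, MvPowerSeries.coeff_monomial]
  split_ifs with h
  · exact h ▸ ha
  · exact zero_mem _

theorem term_mul_term (i j : Fin n →₀ ℕ) (a b : K) :
    term r i a * term r j b = term r (i + j) (a * b) :=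
  Subtype.ext (MvPowerSeries.monomial_mul_monomial i j a b)

theorem coeff_sum_term (s : Finset (Fin n →₀ ℕ)) (c : (Fin n →₀ ℕ) → K) (j : Fin n →₀ ℕ)
    [Decidable (j ∈ s)] :
    MvPowerSeries.coeff j ((∑ i ∈ s, term r i (c i) : tateAlgebra K r) : MvPowerSeries (Fin n) K) =
      if j ∈ s then c j else 0 := by
  classical
  rw [AddSubmonoidClass.coe_finsetSum, map_sum]
  simp only [coe_term, MvPowerSeries.coeff_monomial, Finset.sum_ite_eq]
  congr

/-- Truncation of a series: polynomials are dense in `K{X; r}`. -/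
theorem exists_sub_sum_term_mem_gaussBall (f : tateAlgebra K r) (m : ℝ) :
    ∃ s : Finset (Fin n →₀ ℕ),
      f - ∑ i ∈ s, term r i (MvPowerSeries.coeff i (f : MvPowerSeries (Fin n) K)) ∈
        gaussBall K r m := by
  classical
  -- The exponents kept are those whose term has valuation at most `m`; convergence makes them
  -- finite in number.
  refine ⟨((isConvergent_iff r _).1 f.2 m).toFinset, ?_⟩
  rw [mem_gaussBall_iff]
  intro j
  rw [AddSubgroupClass.coe_sub, map_sub, coeff_sum_term]
  split_ifs with h
  · rw [sub_self]
    exact zero_mem _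
  · rw [Set.Finite.mem_toFinset, Set.mem_ofPred_eq, not_not] at h
    rw [sub_zero]
    exact le_termVal_iff.1 h.le

/-- Completeness of `K{X; r}` for series with linearly growing Gauss valuations. -/
theorem exists_sub_sum_range_mem_gaussBall [(Valued.v (R := K)).IsRankOneDiscrete]
    [CompleteSpace K] {c δ : ℝ} (hδ : 0 < δ) {g : ℕ → tateAlgebra K r}
    (hg : ∀ k : ℕ, g k ∈ gaussBall K r (c + k * δ)) :
    ∃ f : tateAlgebra K r, ∀ N : ℕ,
      f - ∑ k ∈ Finset.range N, g k ∈ gaussBall K r (c + N * δ) := by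
  let G : MvPowerSeries (Fin n) K :=
    fun i => ∑' k, MvPowerSeries.coeff i (g k : MvPowerSeries (Fin n) K)
  have hG : ∀ (N : ℕ) (i : Fin n →₀ ℕ), MvPowerSeries.coeff i
      (G - ((∑ k ∈ Finset.range N, g k : tateAlgebra K r) : MvPowerSeries (Fin n) K)) ∈ valBall K (c + N * δ + dot r i) := by
    intro N i
    have := tsum_sub_sum_mem_valBall (c := c + dot r i) hδ
      (g := fun k => MvPowerSeries.coeff i (g k : MvPowerSeries (Fin n) K))
      (fun k => by convert mem_gaussBall_iff.1 (hg k) i using 2; ring) N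
    rw [map_sub, AddSubmonoidClass.coe_finsetSum, map_sum, add_right_comm]
    exact this
  have hconv : IsConvergent r G := by
    rw [isConvergent_iff]
    intro M
    -- For this `N` every term of the error exceeds `M`, so the exponents where `G` fails the bound
    -- are among those where the partial sum does.
    obtain ⟨N, hN⟩ := exists_nat_gt ((M - c) / δ)
    rw [div_lt_iff₀ hδ] at hN
    refine ((isConvergent_iff r _).1 (∑ k ∈ Finset.range N, g k).2 M).subset fun i hi h => hi ?_
    have h1 : (M : EReal) < termVal r i (MvPowerSeries.coeff i
        (G - ((∑ k ∈ Finset.range N, g k : tateAlgebra K r) : MvPowerSeries (Fin n) K))) :=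
      lt_of_lt_of_le (EReal.coe_lt_coe_iff.2 (by linarith)) (le_termVal_iff.2 (hG N i))
    have h2 := lt_of_lt_of_le (lt_min h1 h) (min_termVal_le r i _ _)
    rwa [← map_add, sub_add_cancel] at h2
  exact ⟨⟨G, hconv⟩, fun N => mem_gaussBall_iff.2 (hG N)⟩

/-- The series in `K{X; r}` all of whose exponents `i` satisfy `i j < d j` for all `j`. -/
def boxSupported (K : Type*) [Field K] [Valued K ℤᵐ⁰] {n : ℕ} (r : Fin n → ℚ) (d : Fin n → ℕ) :
    Submodule K (tateAlgebra K r) where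
  carrier := {f | ∀ i : Fin n →₀ ℕ, (∃ j, d j ≤ i j) →
    MvPowerSeries.coeff i (f : MvPowerSeries (Fin n) K) = 0}
  zero_mem' i _ := by simp
  add_mem' hf hg i hi := by simp [hf i hi, hg i hi]
  smul_mem' c f hf i hi := by simp [hf i hi]

theorem term_mem_boxSupported {d : Fin n → ℕ} {i : Fin n →₀ ℕ} (hi : ∀ j, i j < d j) (a : K) :
    term r i a ∈ boxSupported K r d := by
  rintro i' ⟨j, hj⟩
  refine MvPowerSeries.coeff_monomial_ne ?_ a
  rintro rfl
  exact absurd (hi j) (not_lt.2 hj)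

/-- Closedness of the box space: each coefficient outside the box depends continuously on the
series. -/
theorem mem_boxSupported_of_forall_exists {d : Fin n → ℕ} {f : tateAlgebra K r}
    (h : ∀ m : ℝ, ∃ g ∈ boxSupported K r d, f - g ∈ gaussBall K r m) : f ∈ boxSupported K r d := by
  refine fun i hi => eq_zero_of_forall_mem_valBall fun m => ?_
  obtain ⟨g, hg, hfg⟩ := h (m - dot r i)
  have := mem_gaussBall_iff.1 hfg i
  rwa [AddSubgroupClass.coe_sub, map_sub, hg i hi, sub_zero, sub_add_cancel] at this

theorem finite_box (d : Fin n → ℕ) : {i : Fin n →₀ ℕ | ∀ j, i j < d j}.Finite :=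
  (Set.finite_Iic (Finsupp.equivFunOnFinite.symm d)).subset fun _ hi j => (hi j).le

/-- A linear functional is bounded on the series supported in a box. -/
theorem exists_map_mem_valBall (φ : tateAlgebra K r →ₗ[K] K) (d : Fin n → ℕ) :
    ∃ C : ℝ, ∀ (m : ℝ), ∀ f ∈ boxSupported K r d, f ∈ gaussBall K r m →
      φ f ∈ valBall K (m + C) := by
  classical
  set s := (finite_box d).toFinset
  choose e he using fun i => exists_mem_valBall (φ (term r i 1))
  obtain ⟨C, hC⟩ := (s.image fun i => -(e i + dot r i)).exists_le
  refine ⟨-C, fun m f hf hfm => ?_⟩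
  have hsum : f = ∑ i ∈ s, term r i (MvPowerSeries.coeff i (f : MvPowerSeries (Fin n) K)) := by
    refine Subtype.ext (MvPowerSeries.ext fun i => ?_)
    rw [coeff_sum_term]
    split_ifs with h
    · rfl
    · refine hf i ?_
      simpa [s] using h
  rw [hsum, map_sum]
  refine sum_mem fun i hi => ?_
  have h1 : term r i (MvPowerSeries.coeff i (f : MvPowerSeries (Fin n) K)) =
      MvPowerSeries.coeff i (f : MvPowerSeries (Fin n) K) • term r i 1 := by
    rw [← map_smul, smul_eq_mul, mul_one]
  rw [h1, map_smul, smul_eq_mul]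
  refine valBall_anti ?_ (mul_mem_valBall (mem_gaussBall_iff.1 hfm i) (he i))
  have := hC _ (Finset.mem_image_of_mem _ hi)
  linarith

end GaussBall

/-! ### Weierstrass-type division by one polynomial per variable -/

section Division

variable {K : Type*} [Field K] [Valued K ℤᵐ⁰] {n : ℕ} {r : Fin n → ℚ}

theorem dot_single (i : Fin n) (j : ℕ) : dot r (Finsupp.single i j) = r i * j := by
  rw [dot, Finset.sum_eq_single i]
  · rw [Finsupp.single_eq_same]
  · intro b _ hb
    rw [Finsupp.single_eq_of_ne hb, Nat.cast_zero, mul_zero]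
  · exact fun h => absurd (Finset.mem_univ i) h

theorem term_single_pow (i : Fin n) (j : ℕ) :
    term r (Finsupp.single i 1) (1 : K) ^ j = term r (Finsupp.single i j) 1 := by
  induction j with
  | zero =>
    rw [pow_zero, Finsupp.single_zero]
    rfl
  | succ j ih => rw [pow_succ, ih, term_mul_term, ← Finsupp.single_add, mul_one]

theorem aeval_term_single (i : Fin n) (P : Polynomial K) :
    Polynomial.aeval (term r (Finsupp.single i 1) (1 : K)) P =
      ∑ j ∈ Finset.range (P.natDegree + 1), term r (Finsupp.single i j) (P.coeff j) := by
  rw [Polynomial.aeval_eq_sum_range]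
  refine Finset.sum_congr rfl fun j _ => ?_
  rw [term_single_pow, ← map_smul, smul_eq_mul, mul_one]

/-- The map sending quotients `q` and a remainder `ρ` to `∑ i, q i * p i + ρ`. -/
noncomputable def divisionMap (p : Fin n → tateAlgebra K r) :
    (Fin n → tateAlgebra K r) × tateAlgebra K r →+ tateAlgebra K r :=
  AddMonoidHom.mk' (fun x => ∑ i, x.1 i * p i + x.2) fun x y => by
    simp only [Prod.fst_add, Prod.snd_add, Pi.add_apply, add_mul, Finset.sum_add_distrib]
    abel

theorem divisionMap_apply (p : Fin n → tateAlgebra K r)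
    (x : (Fin n → tateAlgebra K r) × tateAlgebra K r) :
    divisionMap p x = ∑ i, x.1 i * p i + x.2 := rfl

/-- Quotients and remainders of a division of a series of Gauss valuation at least `m` by series
of Gauss valuations `ω`, the remainder having degree less than `d j` in `X j`. -/
noncomputable def divisionPairs (K : Type*) [Field K] [Valued K ℤᵐ⁰] {n : ℕ} (r : Fin n → ℚ) (ω : Fin n → ℝ)
    (d : Fin n → ℕ) (m : ℝ) : AddSubgroup ((Fin n → tateAlgebra K r) × tateAlgebra K r) :=
  (AddSubgroup.pi Set.univ fun i => gaussBall K r (m - ω i)).prod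
    (gaussBall K r m ⊓ (boxSupported K r d).toAddSubgroup)

variable {ω : Fin n → ℝ} {d : Fin n → ℕ}

theorem mem_divisionPairs {m : ℝ} {x : (Fin n → tateAlgebra K r) × tateAlgebra K r} :
    x ∈ divisionPairs K r ω d m ↔ (∀ i, x.1 i ∈ gaussBall K r (m - ω i)) ∧
      x.2 ∈ gaussBall K r m ∧ x.2 ∈ boxSupported K r d := by
  simp [divisionPairs, AddSubgroup.mem_prod, AddSubgroup.mem_pi]

/-- The shift by `ω i` in `divisionPairs` exactly offsets the valuation of `p i`. This bound
replaces a continuity argument when passing to the limit. -/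
theorem divisionMap_mem_gaussBall {p : Fin n → tateAlgebra K r}
    (hp : ∀ i, p i ∈ gaussBall K r (ω i)) {m : ℝ}
    {x : (Fin n → tateAlgebra K r) × tateAlgebra K r} (hx : x ∈ divisionPairs K r ω d m) :
    divisionMap p x ∈ gaussBall K r m := by
  obtain ⟨h1, h2, -⟩ := mem_divisionPairs.1 hx
  refine add_mem (sum_mem fun i _ => ?_) h2
  have := mul_mem_gaussBall (h1 i) (hp i)
  rwa [sub_add_cancel] at this

/-- Division of a term, up to an error of larger Gauss valuation. -/
theorem term_mem_map_divisionMap_sup {P : Fin n → Polynomial K} {δ : ℝ}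
    (hd : ∀ i, val ((P i).coeff (d i)) = ((ω i + r i * d i : ℝ) : EReal))
    (hle : ∀ i, ∀ j : ℕ, (P i).coeff j ∈ valBall K (ω i + r i * j))
    (hlt : ∀ i, ∀ j : ℕ, d i < j → (P i).coeff j ∈ valBall K (ω i + δ + r i * j))
    {m : ℝ} (a : Fin n →₀ ℕ) {c : K} (hc : c ∈ valBall K (m + dot r a)) :
    term r a c ∈
      (divisionPairs K r ω d m).map
        (divisionMap fun i => Polynomial.aeval (term r (Finsupp.single i 1) (1 : K)) (P i)) ⊔
      gaussBall K r (m + δ) := by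
  classical
  -- Replacing $X_i^{d_i}$ through $P_i$ creates terms of lower total degree with no loss of
  -- valuation, left to the induction, and terms of higher degree gaining `δ`, which go into the
  -- error.
  induction hN : a.degree using Nat.strong_induction_on generalizing a c with
  | _ N ih =>
    by_cases hbox : ∀ j, a j < d j
    · refine AddSubgroup.mem_sup_left ⟨(0, term r a c), mem_divisionPairs.2
        ⟨fun i => zero_mem _, term_mem_gaussBall hc, term_mem_boxSupported hbox c⟩, ?_⟩
      simp [divisionMap_apply]
    push Not at hbox
    obtain ⟨i, hi⟩ := hbox
    obtain ⟨b, rfl⟩ : ∃ b, a = b + Finsupp.single i (d i) :=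
      ⟨a - Finsupp.single i (d i), (tsub_add_cancel_of_le (Finsupp.single_le_iff.2 hi)).symm⟩
    have hcd : (P i).coeff (d i) ≠ 0 := fun h => by
      have := hd i
      rw [h, val_zero] at this
      exact EReal.coe_ne_top _ this.symm
    -- Chosen so that the index `d i` term of $c'X^bP_i(X_i)$ is exactly the given term.
    set c' := c * ((P i).coeff (d i))⁻¹ with hc'_def
    have hc' : c' ∈ valBall K (m - ω i + dot r b) := by
      convert mul_mem_valBall hc (inv_mem_valBall (hd i)) using 2
      rw [dot_add, dot_single]
      push_cast
      ring
    have hmul : term r b c' * Polynomial.aeval (term r (Finsupp.single i 1) (1 : K)) (P i) =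
        ∑ j ∈ Finset.range ((P i).natDegree + 1),
          term r (b + Finsupp.single i j) (c' * (P i).coeff j) := by
      rw [aeval_term_single, Finset.mul_sum]
      exact Finset.sum_congr rfl fun j _ => term_mul_term _ _ _ _
    rw [← Finset.add_sum_erase _ _ (Finset.mem_range_succ_iff.2
      (Polynomial.le_natDegree_of_ne_zero hcd)), hc'_def, inv_mul_cancel_right₀ hcd, ← hc'_def]
      at hmul
    rw [eq_sub_of_add_eq hmul.symm]
    refine sub_mem (AddSubgroup.mem_sup_left ⟨(Pi.single i (term r b c'), 0),
      mem_divisionPairs.2 ⟨fun k => ?_, zero_mem _, zero_mem _⟩, ?_⟩) (sum_mem fun j hj => ?_)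
    · by_cases hk : k = i
      · subst hk
        simpa using term_mem_gaussBall hc'
      · simp [hk]
    · rw [divisionMap_apply, add_zero, Finset.sum_eq_single i]
      · simp
      · intro k _ hk
        simp [hk]
      · exact fun h => absurd (Finset.mem_univ i) h
    · rcases lt_or_gt_of_ne (Finset.ne_of_mem_erase hj) with hjd | hjd
      · refine ih _ ?_ _ ?_ rfl
        · rw [← hN, map_add, map_add, Finsupp.degree_single, Finsupp.degree_single]
          omega
        · convert mul_mem_valBall hc' (hle i j) using 2
          rw [dot_add, dot_single]
          push_cast
          ring
      · refine AddSubgroup.mem_sup_right (term_mem_gaussBall ?_)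
        convert mul_mem_valBall hc' (hlt i j hjd) using 2
        rw [dot_add, dot_single]
        push_cast
        ring

theorem aeval_term_single_mem_gaussBall {i : Fin n} {P : Polynomial K} {ω : ℝ}
    (hle : ∀ j : ℕ, P.coeff j ∈ valBall K (ω + r i * j)) :
    Polynomial.aeval (term r (Finsupp.single i 1) (1 : K)) P ∈ gaussBall K r ω := by
  rw [aeval_term_single]
  refine sum_mem fun j _ => term_mem_gaussBall ?_
  rw [dot_single]
  exact_mod_cast hle j

/-- Successive approximation: division up to an error of larger Gauss valuation can be refined to
an exact division. -/
theorem gaussBall_le_map_divisionMap [(Valued.v (R := K)).IsRankOneDiscrete] [CompleteSpace K]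
    {p : Fin n → tateAlgebra K r} (hp : ∀ i, p i ∈ gaussBall K r (ω i)) {δ : ℝ} (hδ : 0 < δ)
    (happrox : ∀ m : ℝ, gaussBall K r m ≤
      (divisionPairs K r ω d m).map (divisionMap p) ⊔ gaussBall K r (m + δ)) (m : ℝ) :
    gaussBall K r m ≤ (divisionPairs K r ω d m).map (divisionMap p) := by
  intro f hf
  have step : ∀ (k : ℕ) (g : tateAlgebra K r), g ∈ gaussBall K r (m + k * δ) →
      ∃ x ∈ divisionPairs K r ω d (m + k * δ),
        g - divisionMap p x ∈ gaussBall K r (m + (k + 1 : ℕ) * δ) := by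
    intro k g hg
    obtain ⟨_, ⟨x, hx, rfl⟩, e, he, rfl⟩ := AddSubgroup.mem_sup.1 (happrox _ hg)
    refine ⟨x, hx, ?_⟩
    rw [add_sub_cancel_left]
    convert he using 2
    push_cast
    ring
  choose! X hX hXe using step
  -- The error left after `k` approximate divisions, which gains `δ` in valuation each time.
  let F : ℕ → tateAlgebra K r := fun k => Nat.rec f (fun k g => g - divisionMap p (X k g)) k
  have hF : ∀ k : ℕ, F k ∈ gaussBall K r (m + k * δ) := by
    intro k
    induction k with
    | zero => simpa [F] using hf
    | succ k ih => exact hXe k _ ih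
  set x : ℕ → (Fin n → tateAlgebra K r) × tateAlgebra K r := fun k => X k (F k) with hx_def
  have hx : ∀ k : ℕ, x k ∈ divisionPairs K r ω d (m + k * δ) := fun k => hX k _ (hF k)
  have hsum : ∀ N : ℕ, f - divisionMap p (∑ k ∈ Finset.range N, x k) = F N := by
    intro N
    induction N with
    | zero => simp [F]
    | succ N ih =>
      rw [Finset.sum_range_succ, map_add, ← sub_sub, ih]
  have hq : ∀ i, ∃ q : tateAlgebra K r, ∀ N : ℕ, q - ∑ k ∈ Finset.range N, (x k).1 i ∈
      gaussBall K r (m - ω i + N * δ) := fun i =>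
    exists_sub_sum_range_mem_gaussBall hδ fun k => by
      convert (mem_divisionPairs.1 (hx k)).1 i using 2
      ring
  choose q hq using hq
  obtain ⟨ρ, hρ⟩ := exists_sub_sum_range_mem_gaussBall (c := m) hδ
    (g := fun k => (x k).2) fun k => (mem_divisionPairs.1 (hx k)).2.1
  have hρbox : ρ ∈ boxSupported K r d := by
    refine mem_boxSupported_of_forall_exists fun M => ?_
    obtain ⟨N, hN⟩ := exists_nat_ge ((M - m) / δ)
    rw [div_le_iff₀ hδ] at hN
    exact ⟨∑ k ∈ Finset.range N, (x k).2, sum_mem fun k _ => (mem_divisionPairs.1 (hx k)).2.2,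
      gaussBall_anti (by linarith) (hρ N)⟩
  have htail : ∀ N : ℕ, (q, ρ) - ∑ k ∈ Finset.range N, x k ∈ divisionPairs K r ω d (m + N * δ) := by
    intro N
    refine mem_divisionPairs.2 ⟨fun i => ?_, ?_, ?_⟩
    · rw [Prod.fst_sub, Prod.fst_sum, Pi.sub_apply, Finset.sum_apply]
      convert hq i N using 2
      ring
    · rw [Prod.snd_sub, Prod.snd_sum]
      exact hρ N
    · rw [Prod.snd_sub, Prod.snd_sum]
      exact sub_mem hρbox (sum_mem fun k _ => (mem_divisionPairs.1 (hx k)).2.2)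
  refine ⟨(q, ρ), by simpa using htail 0, ?_⟩
  refine (sub_eq_zero.1 (eq_zero_of_forall_nat_mem_gaussBall (m := m) hδ fun N => ?_)).symm
  -- The discrepancy is the `N`-th error minus the image of a tail; both have valuation at least `m
  -- + N * δ`, for every `N`.
  have : f - divisionMap p (q, ρ) =
      F N - divisionMap p ((q, ρ) - ∑ k ∈ Finset.range N, x k) := by
    rw [← hsum N, map_sub]
    abel
  rw [this]
  exact sub_mem (hF N) (divisionMap_mem_gaussBall hp (htail N))

/-- Division by nonzero polynomials `P i (X i)`, one for each variable. -/
theorem exists_gaussBall_le_map_divisionMap [(Valued.v (R := K)).IsRankOneDiscrete]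
    [CompleteSpace K] (r : Fin n → ℚ) {P : Fin n → Polynomial K} (hP : ∀ i, P i ≠ 0) :
    ∃ (ω : Fin n → ℝ) (d : Fin n → ℕ), ∀ m : ℝ, gaussBall K r m ≤
      (divisionPairs K r ω d m).map
        (divisionMap fun i => Polynomial.aeval (term r (Finsupp.single i 1) (1 : K)) (P i)) := by
  choose ω δ d hδ hd hle hlt using fun i => exists_dominant_index (hP i) (r i : ℝ)
  -- A single gain valid for all variables: the least gap, or 1 when there are no variables.
  obtain ⟨ε, hε, hεδ⟩ : ∃ ε > 0, ∀ i, ε ≤ δ i := by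
    rcases isEmpty_or_nonempty (Fin n) with he | hn
    · exact ⟨1, one_pos, fun i => isEmptyElim i⟩
    · obtain ⟨i, hi⟩ := Finite.exists_min δ
      exact ⟨δ i, hδ i, hi⟩
  refine ⟨ω, d, gaussBall_le_map_divisionMap
    (fun i => aeval_term_single_mem_gaussBall (hle i)) hε fun m f hf => ?_⟩
  -- The part cut off already counts as error, so only finitely many terms remain to be divided.
  obtain ⟨s, hs⟩ := exists_sub_sum_term_mem_gaussBall f (m + ε)
  rw [← sub_add_cancel f (∑ i ∈ s, term r i (MvPowerSeries.coeff i f.1))]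
  refine add_mem (AddSubgroup.mem_sup_right hs) (sum_mem fun a _ => ?_)
  refine term_mem_map_divisionMap_sup hd hle (fun i j hj => valBall_anti ?_ (hlt i j hj)) a
    (mem_gaussBall_iff.1 hf a)
  linarith [hεδ i]

end Division

/-! ### Closedness of $J$ and density of $I$ in it -/

section Ideal

/-- A zero-dimensional ideal contains a nonzero polynomial in any given element. -/
theorem exists_aeval_mem {K A : Type*} [Field K] [CommRing A] [Algebra K A] (I : Ideal A)
    [Module.Finite K (A ⧸ I)] (x : A) : ∃ P : Polynomial K, P ≠ 0 ∧ Polynomial.aeval x P ∈ I := by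
  obtain ⟨P, hP, h⟩ := Algebra.IsIntegral.isIntegral (R := K) (Ideal.Quotient.mkₐ K I x)
  refine ⟨P, hP.ne_zero, Ideal.Quotient.eq_zero_iff_mem.1 ?_⟩
  rw [← Polynomial.aeval_def, Polynomial.aeval_algHom_apply] at h
  exact h

variable {K : Type*} [Field K] [Valued K ℤᵐ⁰] {n : ℕ}

/-- An ideal containing a nonzero polynomial in each variable is closed. -/
theorem isClosed_ideal [(Valued.v (R := K)).IsRankOneDiscrete] [CompleteSpace K] {r : Fin n → ℚ}
    (J : Ideal (tateAlgebra K r)) {P : Fin n → Polynomial K} (hP : ∀ i, P i ≠ 0)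
    (hJ : ∀ i, Polynomial.aeval (term r (Finsupp.single i 1) (1 : K)) (P i) ∈ J) :
    IsClosed (J : Set (tateAlgebra K r)) := by
  refine isClosed_of_closure_subset fun f hf => ?_
  by_contra hfJ
  obtain ⟨φ, hφf, hφ⟩ := Submodule.exists_le_ker_of_notMem
    (p := J.restrictScalars K) (v := f) hfJ
  obtain ⟨ω, d, hdiv⟩ := exists_gaussBall_le_map_divisionMap r hP
  obtain ⟨C, hC⟩ := exists_map_mem_valBall φ d
  refine hφf (eq_zero_of_forall_mem_valBall fun m => ?_)
  -- The shift by `C` absorbs the bound of `φ` on the box.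
  obtain ⟨g, hg, hfg⟩ := mem_closure_iff_gaussBall.1 hf (m - C)
  obtain ⟨x, hx, hxfg⟩ := hdiv _ hfg
  obtain ⟨-, hx1, hx2⟩ := mem_divisionPairs.1 hx
  have h1 : φ f = φ x.2 := by
    have hmem : f - x.2 ∈ J := by
      rw [divisionMap_apply] at hxfg
      have : f - x.2 = g + ∑ i, x.1 i *
          Polynomial.aeval (term r (Finsupp.single i 1) (1 : K)) (P i) := by
        linear_combination -hxfg
      rw [this]
      exact add_mem hg (sum_mem fun i _ => J.mul_mem_left _ (hJ i))
    exact sub_eq_zero.1 ((map_sub φ _ _).symm.trans (hφ hmem))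
  rw [h1]
  simpa using hC _ _ hx2 hx1

theorem inclusion_term {u r : Fin n → ℚ} (h : u ≤ r) (i : Fin n →₀ ℕ) (a : K) :
    inclusion h (term r i a) = term u i a := rfl

/-- The ideal of `K{X; u}` generated by an ideal of `K{X; r}` is contained in its closure. -/
theorem map_inclusion_subset_closure {u r : Fin n → ℚ} (hur : u ≤ r)
    (I : Ideal (tateAlgebra K r)) :
    (I.map (inclusion (K := K) hur) : Set (tateAlgebra K u)) ⊆
      closure (inclusion (K := K) hur '' (I : Set (tateAlgebra K r))) := by
  intro f hf
  refine Submodule.span_induction (fun x hx => subset_closure hx) ?_ ?_ ?_ hf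
  · exact subset_closure ⟨0, zero_mem _, map_zero _⟩
  · intro x y _ _ hx hy
    rw [mem_closure_iff_gaussBall] at *
    intro m
    obtain ⟨_, ⟨g, hg, rfl⟩, hxg⟩ := hx m
    obtain ⟨_, ⟨g', hg', rfl⟩, hyg⟩ := hy m
    refine ⟨_, ⟨g + g', add_mem hg hg', rfl⟩, ?_⟩
    rw [map_add, add_sub_add_comm]
    exact add_mem hxg hyg
  · intro a x _ hx
    rw [mem_closure_iff_gaussBall] at *
    intro m
    obtain ⟨l, hl⟩ := exists_mem_gaussBall x
    -- The multiplier `a` is truncated to a polynomial `b`, which comes from $K\{\mathbf X;\mathbf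
    -- r\}$. The precisions `m - l` and, below, `m - l'` make both summands of $(a-b)x+b(x-g)$ have
    -- valuation at least `m`.
    obtain ⟨s, hs⟩ := exists_sub_sum_term_mem_gaussBall a (m - l)
    set b := ∑ i ∈ s, term u i (MvPowerSeries.coeff i (a : MvPowerSeries (Fin n) K))
    obtain ⟨l', hl'⟩ := exists_mem_gaussBall b
    obtain ⟨_, ⟨g, hg, rfl⟩, hxg⟩ := hx (m - l')
    refine ⟨_, ⟨(∑ i ∈ s, term r i (MvPowerSeries.coeff i (a : MvPowerSeries (Fin n) K))) * g,
      I.mul_mem_left _ hg, rfl⟩, ?_⟩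
    have hb : inclusion hur
        (∑ i ∈ s, term r i (MvPowerSeries.coeff i (a : MvPowerSeries (Fin n) K))) = b := by
      rw [map_sum]
      rfl
    have : a • x - inclusion hur
        ((∑ i ∈ s, term r i (MvPowerSeries.coeff i (a : MvPowerSeries (Fin n) K))) * g) =
        (a - b) * x + b * (x - inclusion hur g) := by
      rw [map_mul, hb, smul_eq_mul]
      ring
    rw [this]
    refine add_mem ?_ ?_
    · simpa using mul_mem_gaussBall hs hl
    · simpa using mul_mem_gaussBall hl' hxg

end Ideal

end TateAlgebra

theorem mainTheorem8 {K : Type*} [Field K] [hK : Valued K ℤᵐ⁰]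
    [hdisc : (hK.v).IsRankOneDiscrete] [hcomplete : CompleteSpace K]
    (n : ℕ) (r u : Fin n → ℚ) (hur : u ≤ r)
    (I : Ideal (tateAlgebra K r))
    (hI : Module.Finite K (tateAlgebra K r ⧸ I)) :
    ((I.map (TateAlgebra.inclusion (K := K) hur) : Ideal (tateAlgebra K u)) :
        Set (tateAlgebra K u)) =
      closure (TateAlgebra.inclusion (K := K) hur '' (I : Set (tateAlgebra K r))) := by
  refine (TateAlgebra.map_inclusion_subset_closure hur I).antisymm ?_
  choose P hP hPI using fun i =>
    TateAlgebra.exists_aeval_mem (K := K) I (TateAlgebra.term r (Finsupp.single i 1) (1 : K))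
  refine closure_minimal ?_ (TateAlgebra.isClosed_ideal _ hP fun i => ?_)
  · rintro _ ⟨g, hg, rfl⟩
    exact Ideal.mem_map_of_mem _ hg
  · have := Ideal.mem_map_of_mem (TateAlgebra.inclusion (K := K) hur) (hPI i)
    rwa [← Polynomial.aeval_algHom_apply, TateAlgebra.inclusion_term] at this
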